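/- **Setting.** There are $n\ge 1$ agents. Agent $i$ has a public weight $w_i>0$ and a private preferred location $p_i\in\mathbb{R}^2$. Let $W_{\min}=\min_i w_i$, $W_{\max}=\max_i w_i$, and let $d$ be the Euclidean distance. If the facility is placed at $q$, agent $i$ has cost $w_i\,d(q,p_i)$, and the social (utilitarian) cost is $C(q,P)=\frac1n\sum_{i=1}^n w_i\,d(q,p_i)$, where $P=(p_1,\dots,p_n)$. A location $o$ is optimal for $P$ if it minimizes $C(\cdot,P)$. A deterministic mechanism with prediction is a function $f$ that maps the reported profile $P\in(\mathbb{R}^2)^n$ and a prediction $\hat o\in\mathbb{R}^2$ to a facility location $f(P,\hat o)\in\mathbb{R}^2$. It is *strategyproof* if, for every $\hat o$, every profile and every agent, reporting the true location minimizes that agent's cost, whatever the other reports. It is *$\alpha$-consistent* if $C(f(P,o),P)\le\alpha\,C(o,P)$ for every $P$ and every optimal location $o$ of $P$, and *$\beta$-robust* if $C(f(P,\hat o),P)\le\beta\,C(o,P)$ for every $P$, every prediction $\hat o$ and every optimal location $o$ of $P$. For $c\in[0,1)$, the *Coordinate Median with Prediction* (CMP) mechanism adds $\lfloor cn\rfloor$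 copies of $\hat o$ to the $n$ reported locations and returns the coordinate-wise median of the resulting multiset (the smaller of the two medians if its size is even). **Theorem.** Let $n\ge1$ and $c\in[0,1)$, and put $$\alpha=\frac{\sqrt{(1+c)^2W_{\min}^2+(1-c)^2W_{\max}^2}}{(1+c)W_{\min}},\qquad \beta=\frac{\sqrt{(1-c)^2W_{\min}^2+(1+c)^2W_{\max}^2}}{(1-c)W_{\min}}.$$ 1. There is a deterministic mechanism, not depending on the weights, that for all positive weights $w_1,\dots,w_n$ is strategyproof, $\alpha$-consistent and $\beta$-robust. 2. For all positive weights, the CMP mechanism with parameter $c$ is strategyproof and $\beta$-robust, and if $cn$ is an integer (so that exactly $cn$ copies of the prediction are added), it is also $\alpha$-consistent. -/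

import Mathlib

noncomputable section

namespace FacilityLocation

/-- The Euclidean plane `ℝ²`. -/
abbrev Plane : Type := EuclideanSpace ℝ (Fin 2)

/-- A (deterministic) mechanism with prediction for `n` agents: a function of the reported
location profile and of the predicted optimal location, returning the facility location. -/
abbrev Mechanism (n : ℕ) : Type := (Fin n → Plane) → Plane → Plane

/-- Individual cost of an agent with weight `w` and preferred location `p`, facility at `f`. -/
def agentCost (w : ℝ) (f p : Plane) : ℝ := w * dist f p

/-- Weighted utilitarian cost: the average weighted distance of the agents to `f`. -/
def socialCost {n : ℕ} (w : Fin n → ℝ) (f : Plane) (P : Fin n → Plane) : ℝ :=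
  (1 / (n : ℝ)) * ∑ i, agentCost (w i) f (P i)

/-- `o` is an optimal facility location for the profile `P`. -/
def IsOptimal {n : ℕ} (w : Fin n → ℝ) (P : Fin n → Plane) (o : Plane) : Prop :=
  ∀ q : Plane, socialCost w o P ≤ socialCost w q P

/-- No agent can decrease her own cost by misreporting, whatever the prediction and the reports
of the others. -/
def Strategyproof {n : ℕ} (w : Fin n → ℝ) (f : Mechanism n) : Prop :=
  ∀ (ohat : Plane) (P : Fin n → Plane) (i : Fin n) (p' : Plane),
    agentCost (w i) (f P ohat) (P i) ≤ agentCost (w i) (f (Function.update P i p') ohat) (P i)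

/-- `α`-consistency: when the prediction is an optimal location, the cost of the outcome is at most
`α` times the optimal cost. (Without division, so that a zero optimal cost forces a zero cost.) -/
def Consistent {n : ℕ} (w : Fin n → ℝ) (α : ℝ) (f : Mechanism n) : Prop :=
  ∀ (P : Fin n → Plane) (o : Plane), IsOptimal w P o →
    socialCost w (f P o) P ≤ α * socialCost w o P

/-- `β`-robustness: for every prediction, the cost of the outcome is at most `β` times the optimal
cost. -/
def Robust {n : ℕ} (w : Fin n → ℝ) (β : ℝ) (f : Mechanism n) : Prop :=
  ∀ (P : Fin n → Plane) (ohat o : Plane), IsOptimal w P o →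
    socialCost w (f P ohat) P ≤ β * socialCost w o P

/-- The median of a multiset of reals; the smaller of the two medians if the cardinality is even.
(The default value `0` is only used for the empty multiset.) -/
def lowerMedian (s : Multiset ℝ) : ℝ :=
  (s.sort (· ≤ ·)).getD ((Multiset.card s - 1) / 2) 0

/-- Coordinate Median with Prediction with confidence `c`: add `⌊c n⌋` copies of the prediction to
the reported locations and return the coordinate-wise median. -/
def cmp {n : ℕ} (c : ℝ) : Mechanism n := fun P ohat =>
  WithLp.toLp 2 fun k : Fin 2 =>
    lowerMedian
      ((Finset.univ : Finset (Fin n)).val.map (fun i => P i k) +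
        Multiset.replicate ⌊c * (n : ℝ)⌋₊ (ohat k))

/-- The minimum weight. -/
def wMin {n : ℕ} (w : Fin n → ℝ) : ℝ := ⨅ i, w i

/-- The maximum weight. -/
def wMax {n : ℕ} (w : Fin n → ℝ) : ℝ := ⨆ i, w i

/-- The consistency bound. -/
def consistencyBound (c Wmin Wmax : ℝ) : ℝ :=
  Real.sqrt ((1 + c) ^ 2 * Wmin ^ 2 + (1 - c) ^ 2 * Wmax ^ 2) / ((1 + c) * Wmin)

/-- The robustness bound. -/
def robustnessBound (c Wmin Wmax : ℝ) : ℝ :=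
  Real.sqrt ((1 - c) ^ 2 * Wmin ^ 2 + (1 + c) ^ 2 * Wmax ^ 2) / ((1 - c) * Wmin)

end FacilityLocation

end

namespace FacilityLocation

open Finset

/-! ### Order statistics of the lower median. -/

section LowerMedian

/-! Both guarantees reduce to one fact (`socialCost_le_of_card_opposite`): if in each coordinate at
least `(1 + c) n / 2` agents are weakly across `f` from `o`, then `f` costs at most
`consistencyBound c` times `o`. With `k` copies of a correct prediction, the copies lie on the side
of `o`, so about `(n + k) / 2` agents are across; with an arbitrary prediction up to `k` of these
places may be taken by copies, leaving about `(n - k) / 2`. Hence robustness is the same fact with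
`-c` for `c`.

The fact is proved by a linear programming dual certificate. With ratio `√(1 + γ²)`,
`exists_dual_weights` bounds each agent's excess cost by `M * N`, minus `A` if the agent is across
in the first coordinate, minus `B` if across in the second. Since `A + B = (M + γ m) N` and `(1 +
c)(M + γ m) = 2 M`, the sum over the agents is at most zero.

Strategyproofness holds coordinate by coordinate: a misreport never brings a median closer to the
true coordinate. -/

lemma lowerMedian_eq_getElem (s : Multiset ℝ)
    (h : (s.card - 1) / 2 < (s.sort (· ≤ ·)).length) :
    lowerMedian s = (s.sort (· ≤ ·))[(s.card - 1) / 2] := by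
  rw [lowerMedian, List.getD_eq_getElem _ _ h]

lemma lt_countP_le_lowerMedian {s : Multiset ℝ} (hs : 0 < s.card) :
    (s.card - 1) / 2 < s.countP (· ≤ lowerMedian s) := by
  have hlen : (s.sort (· ≤ ·)).length = s.card := Multiset.length_sort _
  have hj : (s.card - 1) / 2 < (s.sort (· ≤ ·)).length := by omega
  have hsort : (s.sort (· ≤ ·)).Pairwise (· ≤ ·) := Multiset.pairwise_sort s (· ≤ ·)
  have hs' := (Multiset.sort_eq s (· ≤ ·)).symm
  rw [lowerMedian_eq_getElem s hj, congrArg (Multiset.countP _) hs', Multiset.coe_countP]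
  clear hs'
  generalize s.sort (· ≤ ·) = l at *
  generalize (s.card - 1) / 2 = j at *
  have h1 : (l.take (j + 1)).countP (fun x => decide (x ≤ l[j])) = (l.take (j + 1)).length := by
    rw [List.countP_eq_length]
    intro x hx
    obtain ⟨i, hi, rfl⟩ := List.mem_iff_getElem.1 hx
    simp only [List.length_take] at hi
    simp only [List.getElem_take, decide_eq_true_eq]
    rcases (show i ≤ j by omega).eq_or_lt with rfl | hij
    · exact le_rfl
    · exact List.pairwise_iff_getElem.1 hsort i j (by omega) hj hij
  have h2 := (List.take_sublist (j + 1) l).countP_le (p := fun x => decide (x ≤ l[j]))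
  rw [h1, List.length_take] at h2
  omega

lemma sub_le_countP_lowerMedian_le {s : Multiset ℝ} (hs : 0 < s.card) :
    s.card - (s.card - 1) / 2 ≤ s.countP (lowerMedian s ≤ ·) := by
  have hlen : (s.sort (· ≤ ·)).length = s.card := Multiset.length_sort _
  have hj : (s.card - 1) / 2 < (s.sort (· ≤ ·)).length := by omega
  have hsort : (s.sort (· ≤ ·)).Pairwise (· ≤ ·) := Multiset.pairwise_sort s (· ≤ ·)
  have hs' := (Multiset.sort_eq s (· ≤ ·)).symm
  rw [lowerMedian_eq_getElem s hj, congrArg (Multiset.countP _) hs', Multiset.coe_countP]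
  clear hs'
  generalize s.sort (· ≤ ·) = l at *
  generalize (s.card - 1) / 2 = j at *
  have h1 : (l.drop j).countP (fun x => decide (l[j] ≤ x)) = (l.drop j).length := by
    rw [List.countP_eq_length]
    intro x hx
    obtain ⟨i, hi, rfl⟩ := List.mem_iff_getElem.1 hx
    simp only [List.length_drop] at hi
    simp only [List.getElem_drop, decide_eq_true_eq]
    rcases Nat.eq_zero_or_pos i with rfl | hi0
    · simp
    · exact List.pairwise_iff_getElem.1 hsort j (j + i) hj (by omega) (by omega)
  have h2 := (List.drop_sublist j l).countP_le (p := fun x => decide (l[j] ≤ x))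
  rw [h1, List.length_drop] at h2
  omega

/-- The two counts concern disjoint sets of entries. This turns the rank bounds at the median into
criteria for comparing it with any `t`. -/
lemma countP_le_add_countP_ge_le_card (s : Multiset ℝ) {a b : ℝ} (hab : a < b) :
    s.countP (· ≤ a) + s.countP (b ≤ ·) ≤ s.card := by
  rw [Multiset.card_eq_countP_add_countP (· ≤ a) s]
  refine Nat.add_le_add_left ?_ _
  rw [Multiset.countP_eq_card_filter, Multiset.countP_eq_card_filter]
  exact Multiset.card_le_card
    (Multiset.monotone_filter_right s fun x hx => not_le.2 (hab.trans_le hx))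

lemma lowerMedian_le_of_lt_countP {s : Multiset ℝ} (hs : 0 < s.card) {t : ℝ}
    (h : (s.card - 1) / 2 < s.countP (· ≤ t)) : lowerMedian s ≤ t := by
  by_contra! hlt
  have h1 := countP_le_add_countP_ge_le_card s hlt
  have h2 := sub_le_countP_lowerMedian_le hs
  omega

lemma le_lowerMedian_of_le_countP {s : Multiset ℝ} (hs : 0 < s.card) {t : ℝ}
    (h : s.card - (s.card - 1) / 2 ≤ s.countP (t ≤ ·)) : t ≤ lowerMedian s := by
  by_contra! hlt
  have h1 := countP_le_add_countP_ge_le_card s hlt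
  have h2 := lt_countP_le_lowerMedian hs
  omega

/-- Replacing one entry `x` of a multiset does not bring the lower median closer to `x`. -/
lemma abs_lowerMedian_cons_sub_le (s : Multiset ℝ) (x y : ℝ) :
    |lowerMedian (x ::ₘ s) - x| ≤ |lowerMedian (y ::ₘ s) - x| := by
  have hx : 0 < (x ::ₘ s).card := by simp
  have hy : 0 < (y ::ₘ s).card := by simp
  rcases lt_trichotomy (lowerMedian (x ::ₘ s)) x with h | h | h
  · have h1 := lt_countP_le_lowerMedian hx
    -- The entry `x` lies above the median, so the other entries alone already force the new median
    -- to be no larger, whatever `y` is.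
    rw [Multiset.countP_cons_of_neg (p := (· ≤ lowerMedian (x ::ₘ s))) _ (not_le.2 h)] at h1
    have h2 : lowerMedian (y ::ₘ s) ≤ lowerMedian (x ::ₘ s) := by
      apply lowerMedian_le_of_lt_countP hy
      have := Multiset.countP_le_of_le (· ≤ lowerMedian (x ::ₘ s)) (Multiset.le_cons_self s y)
      simp only [Multiset.card_cons] at h1 ⊢
      omega
    rw [abs_of_neg (by linarith), abs_of_neg (by linarith)]
    linarith
  · simp [h]
  · have h1 := sub_le_countP_lowerMedian_le hx
    rw [Multiset.countP_cons_of_neg (p := (lowerMedian (x ::ₘ s) ≤ ·)) _ (not_le.2 h)] at h1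
    have h2 : lowerMedian (x ::ₘ s) ≤ lowerMedian (y ::ₘ s) := by
      apply le_lowerMedian_of_le_countP hy
      have := Multiset.countP_le_of_le (lowerMedian (x ::ₘ s) ≤ ·) (Multiset.le_cons_self s y)
      simp only [Multiset.card_cons] at h1 ⊢
      omega
    rw [abs_of_pos (by linarith), abs_of_pos (by linarith)]
    linarith

end LowerMedian

/-! ### Strategyproofness and the number of agents across the median. -/

section Mechanism

/-- The coordinate-wise lower median of the reports and `k` copies of the prediction. -/
noncomputable def medianWithCopies {n : ℕ} (k : ℕ) : Mechanism n := fun P ohat =>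
  WithLp.toLp 2 fun j : Fin 2 =>
    lowerMedian ((univ : Finset (Fin n)).val.map (fun i => P i j) + Multiset.replicate k (ohat j))

lemma plane_dist_eq (p q : Plane) : dist p q = √((p 0 - q 0) ^ 2 + (p 1 - q 1) ^ 2) := by
  simp [EuclideanSpace.dist_eq, Real.dist_eq, Fin.sum_univ_two]

lemma map_univ_eq_cons {n : ℕ} (g : Fin n → ℝ) (i : Fin n) :
    (univ : Finset (Fin n)).val.map g = g i ::ₘ (univ.erase i).val.map g := by
  rw [← Multiset.map_cons, ← Finset.insert_val_of_notMem (by simp),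
    Finset.insert_erase (mem_univ i)]

lemma medianWithCopies_strategyproof {n : ℕ} (k : ℕ) {w : Fin n → ℝ} (hw : ∀ i, 0 < w i) :
    Strategyproof w (medianWithCopies k) := by
  intro ohat P i p'
  have key : ∀ j : Fin 2, |medianWithCopies k P ohat j - P i j| ≤
      |medianWithCopies k (Function.update P i p') ohat j - P i j| := by
    intro j
    have hmap : ((univ.erase i).val.map fun l => Function.update P i p' l j) =
        (univ.erase i).val.map fun l => P l j := by
      refine Multiset.map_congr rfl fun l hl => ?_
      rw [Function.update_of_ne (Finset.ne_of_mem_erase (Finset.mem_def.2 hl))]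
    simp only [medianWithCopies]
    rw [map_univ_eq_cons _ i, map_univ_eq_cons (fun l => Function.update P i p' l j) i, hmap,
      Multiset.cons_add, Multiset.cons_add]
    exact abs_lowerMedian_cons_sub_le _ _ _
  refine mul_le_mul_of_nonneg_left ?_ (hw i).le
  rw [plane_dist_eq, plane_dist_eq]
  exact Real.sqrt_le_sqrt (add_le_add (sq_le_sq.2 (key 0)) (sq_le_sq.2 (key 1)))

lemma countP_replicate_eq_ite (p : ℝ → Prop) [DecidablePred p] (k : ℕ) (x : ℝ) :
    (Multiset.replicate k x).countP p = if p x then k else 0 := by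
  rw [← Multiset.coe_replicate, Multiset.coe_countP, List.countP_replicate]
  simp

variable {n : ℕ} (k : ℕ) (P : Fin n → Plane) (ohat : Plane) (j : Fin 2)

lemma lt_card_le_median_add (hn : 0 < n) :
    (n + k - 1) / 2 < #{i | P i j ≤ medianWithCopies k P ohat j} +
      if ohat j ≤ medianWithCopies k P ohat j then k else 0 := by
  have h := lt_countP_le_lowerMedian
    (s := univ.val.map (fun i => P i j) + Multiset.replicate k (ohat j)) (by simp; omega)
  rw [Multiset.countP_add, Multiset.countP_map, countP_replicate_eq_ite] at h
  simpa [medianWithCopies, Finset.card_def] using h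

lemma le_card_median_le_add (hn : 0 < n) :
    n + k - (n + k - 1) / 2 ≤ #{i | medianWithCopies k P ohat j ≤ P i j} +
      if medianWithCopies k P ohat j ≤ ohat j then k else 0 := by
  have h := sub_le_countP_lowerMedian_le
    (s := univ.val.map (fun i => P i j) + Multiset.replicate k (ohat j)) (by simp; omega)
  rw [Multiset.countP_add, Multiset.countP_map, countP_replicate_eq_ite] at h
  simpa [medianWithCopies, Finset.card_def] using h

/-- At least about `(n - k) / 2` agents are not on the side of `o` of the median. -/
lemma card_opposite_arbitrary (hn : 0 < n) (o : Plane) :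
    (n + k - 1) / 2 + 1 ≤ #{i | (P i j - medianWithCopies k P ohat j) *
      (o j - medianWithCopies k P ohat j) ≤ 0} + k := by
  rcases le_total (medianWithCopies k P ohat j) (o j) with h | h
  · have h1 := lt_card_le_median_add k P ohat j hn
    have h2 : #{i | P i j ≤ medianWithCopies k P ohat j} ≤
        #{i | (P i j - medianWithCopies k P ohat j) *
          (o j - medianWithCopies k P ohat j) ≤ 0} :=
      card_le_card <| monotone_filter_right _ fun i _ hi =>
        mul_nonpos_of_nonpos_of_nonneg (sub_nonpos.2 hi) (sub_nonneg.2 h)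
    split_ifs at h1 <;> omega
  · have h1 := le_card_median_le_add k P ohat j hn
    have h2 : #{i | medianWithCopies k P ohat j ≤ P i j} ≤
        #{i | (P i j - medianWithCopies k P ohat j) *
          (o j - medianWithCopies k P ohat j) ≤ 0} :=
      card_le_card <| monotone_filter_right _ fun i _ hi =>
        mul_nonpos_of_nonneg_of_nonpos (sub_nonneg.2 hi) (sub_nonpos.2 h)
    split_ifs at h1 <;> omega

/-- At least about `(n + k) / 2` agents are not on the side of the prediction of the median. -/
lemma card_opposite_prediction (hn : 0 < n) (hk : k ≤ n) :
    (n + k - 1) / 2 + 1 ≤ #{i | (P i j - medianWithCopies k P ohat j) *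
      (ohat j - medianWithCopies k P ohat j) ≤ 0} := by
  rcases lt_trichotomy (medianWithCopies k P ohat j) (ohat j) with h | h | h
  · have h1 := lt_card_le_median_add k P ohat j hn
    rw [if_neg (not_le.2 h), add_zero] at h1
    refine h1.trans_le (card_le_card <| monotone_filter_right _ fun i _ hi =>
        mul_nonpos_of_nonpos_of_nonneg (sub_nonpos.2 hi) (sub_nonneg.2 h.le))
  -- All `n` agents count here, and `k ≤ n` makes that enough.
  · simp only [h, sub_self, mul_zero, le_refl, filter_true, card_univ, Fintype.card_fin]
    omega
  · have h1 := le_card_median_le_add k P ohat j hn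
    rw [if_neg (not_le.2 h)] at h1
    have h2 : #{i | medianWithCopies k P ohat j ≤ P i j} ≤
        #{i | (P i j - medianWithCopies k P ohat j) *
          (ohat j - medianWithCopies k P ohat j) ≤ 0} :=
      card_le_card <| monotone_filter_right _ fun i _ hi =>
        mul_nonpos_of_nonneg_of_nonpos (sub_nonneg.2 hi) (sub_nonpos.2 h.le)
    omega

end Mechanism

/-! ### Norm inequalities for one agent, with the facility at the origin and `o` at `(a, b)`. -/

section PlaneInequalities

/-- Cauchy–Schwarz for `(1, γ)` and `(X, Y)`; the source of the factor `√(1 + γ²)`. -/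
lemma add_mul_le_sqrt_mul_sqrt (γ X Y : ℝ) {Z : ℝ} (h : X ^ 2 + Y ^ 2 ≤ Z) :
    X + γ * Y ≤ √(1 + γ ^ 2) * √Z := by
  rw [← Real.sqrt_mul (by positivity)]
  apply Real.le_sqrt_of_sq_le
  nlinarith [sq_nonneg (Y - γ * X), mul_le_mul_of_nonneg_left h (by positivity : 0 ≤ 1 + γ ^ 2)]

lemma abs_sub_sq_ge {x a : ℝ} (h : x * a ≤ 0) : (x - a) ^ 2 = (|x| + |a|) ^ 2 := by
  have h1 : |x| * |a| = -(x * a) := by rw [← abs_mul, abs_of_nonpos h]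
  nlinarith [sq_abs x, sq_abs a]

lemma sqrt_sq_add_sq_le_abs_add_abs (x y : ℝ) : √(x ^ 2 + y ^ 2) ≤ |x| + |y| := by
  rw [Real.sqrt_le_left (by positivity)]
  nlinarith [sq_abs x, sq_abs y, mul_nonneg (abs_nonneg x) (abs_nonneg y)]

lemma sqrt_sq_add_sq_sub_le (x y a b : ℝ) :
    √(x ^ 2 + y ^ 2) ≤ √((x - a) ^ 2 + (y - b) ^ 2) + √(a ^ 2 + b ^ 2) := by
  simpa only [plane_dist_eq, PiLp.toLp_apply, Matrix.cons_val_zero, Matrix.cons_val_one,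
    PiLp.zero_apply, sub_zero] using dist_triangle (!₂[x, y] : Plane) !₂[a, b] 0

variable {γ x y a b : ℝ}

/-- The triangle inequality absorbs the displacement `b`; the remaining displacement `a` is opposite
to `x`, so `(x - a)² ≥ x² + a²` and Cauchy–Schwarz applies. -/
lemma norm_bound_of_left (hx : x * a ≤ 0) :
    √(x ^ 2 + y ^ 2) + γ * |a| ≤ √(1 + γ ^ 2) * √((x - a) ^ 2 + (y - b) ^ 2) + |b| := by
  have h1 : √(x ^ 2 + y ^ 2) ≤ √(x ^ 2 + (y - b) ^ 2) + |b| := by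
    simpa [Real.sqrt_sq_eq_abs] using sqrt_sq_add_sq_sub_le x y 0 b
  have h2 : √(x ^ 2 + (y - b) ^ 2) + γ * |a| ≤
      √(1 + γ ^ 2) * √((x - a) ^ 2 + (y - b) ^ 2) := by
    apply add_mul_le_sqrt_mul_sqrt
    rw [Real.sq_sqrt (by positivity), sq_abs]
    linarith
  linarith

lemma norm_bound_of_opposite (hx : x * a ≤ 0) (hy : y * b ≤ 0) :
    √(x ^ 2 + y ^ 2) + γ * √(a ^ 2 + b ^ 2) ≤
      √(1 + γ ^ 2) * √((x - a) ^ 2 + (y - b) ^ 2) := by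
  apply add_mul_le_sqrt_mul_sqrt
  rw [Real.sq_sqrt (by positivity), Real.sq_sqrt (by positivity)]
  linarith

/-- Cauchy–Schwarz with `X = |(x, y)| + |a|` and `Y = |b|`: the cross term `|(x, y)| |a|` is at most
`|x| |a| + |y| |b|`, because `|a| ≤ |b|`. -/
lemma norm_bound_of_opposite_of_le (hx : x * a ≤ 0) (hy : y * b ≤ 0) (hab : |a| ≤ |b|) :
    √(x ^ 2 + y ^ 2) + |a| + γ * |b| ≤
      √(1 + γ ^ 2) * √((x - a) ^ 2 + (y - b) ^ 2) := by
  apply add_mul_le_sqrt_mul_sqrt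
  have h1 := sqrt_sq_add_sq_le_abs_add_abs x y
  have h2 : √(x ^ 2 + y ^ 2) ^ 2 = |x| ^ 2 + |y| ^ 2 := by
    rw [Real.sq_sqrt (by positivity), sq_abs, sq_abs]
  rw [abs_sub_sq_ge hx, abs_sub_sq_ge hy]
  nlinarith [mul_le_mul_of_nonneg_left h1 (abs_nonneg a),
    mul_le_mul_of_nonneg_left hab (abs_nonneg y)]

lemma norm_bound_of_opposite_of_le_one (hγ1 : γ ≤ 1) (hx : x * a ≤ 0) (hy : y * b ≤ 0) :
    √(x ^ 2 + y ^ 2) + γ * (|a| + |b|) ≤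
      √(1 + γ ^ 2) * √((x - a) ^ 2 + (y - b) ^ 2) := by
  rcases le_total |a| |b| with h | h
  · have := norm_bound_of_opposite_of_le (γ := γ) hx hy h
    nlinarith [mul_le_mul_of_nonneg_right hγ1 (abs_nonneg a)]
  · have := norm_bound_of_opposite_of_le (γ := γ) hy hx h
    rw [add_comm (y ^ 2), add_comm ((y - b) ^ 2)] at this
    nlinarith [mul_le_mul_of_nonneg_right hγ1 (abs_nonneg b)]

end PlaneInequalities

/-! ### The dual certificate for a single agent. -/

section DualWeights

lemma mul_le_max_of_mem {w m M t : ℝ} (hm : m ≤ w) (hM : w ≤ M) :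
    w * t ≤ max (m * t) (M * t) := by
  rcases le_total 0 t with ht | ht
  · exact (mul_le_mul_of_nonneg_right hM ht).trans (le_max_right _ _)
  · exact (mul_le_mul_of_nonpos_right hm ht).trans (le_max_left _ _)

/-- Splitting of a budget `S` into two parts below given nonnegative caps. -/
lemma exists_add_eq_of_le_add {U V S : ℝ} (hU : 0 ≤ U) (hV : 0 ≤ V) (hS : 0 ≤ S)
    (h : S ≤ U + V) : ∃ A B, 0 ≤ A ∧ 0 ≤ B ∧ A ≤ U ∧ B ≤ V ∧ A + B = S := by
  refine ⟨min U S, S - min U S, le_min hU hS, sub_nonneg.2 (min_le_right _ _), min_le_left _ _,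
    ?_, by ring⟩
  rcases min_cases U S with h | h <;> linarith

variable {γ m M a b N : ℝ}

lemma max_mul_sub_le (hγ : 0 ≤ γ) (hm : 0 < m) (hmM : m ≤ M) (ha : 0 ≤ a) (hbN : b ≤ N)
    (hN : 0 ≤ N) : max (m * (b - γ * a)) (M * (b - γ * a)) ≤ M * N := by
  have h : b - γ * a ≤ N := by nlinarith [mul_nonneg hγ ha]
  apply max_le
  · nlinarith
  · nlinarith

lemma budget_le_of_le_one (hγ0 : 0 ≤ γ) (hmM : m ≤ M)
    (ha : 0 ≤ a) (hb : 0 ≤ b) :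
    (M + γ * m) * (a + b) + max (m * (b - γ * a)) (M * (b - γ * a)) +
      max (m * (a - γ * b)) (M * (a - γ * b)) ≤ 2 * (M * (a + b)) := by
  have hd : 0 ≤ M - m := by linarith
  have e1 := mul_nonneg hd ha
  have e2 := mul_nonneg hd hb
  have e3 := mul_nonneg hγ0 e1
  have e4 := mul_nonneg hγ0 e2
  rcases max_cases (m * (b - γ * a)) (M * (b - γ * a)) with ⟨h, -⟩ | ⟨h, -⟩ <;>
  rcases max_cases (m * (a - γ * b)) (M * (a - γ * b)) with ⟨h', -⟩ | ⟨h', -⟩ <;>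
  rw [h, h'] <;> nlinarith

/-- The left side is a maximum of four expressions. If both maxima use `m`, `N ≤ a + b` suffices; if
both use `M`, `m ≤ M` does. The mixed cases depend on the sign of `M - γ m`, the coefficient of `t`,
which decides whether `t ≤ N` or `t ≥ N - s` is used. -/
lemma budget_le_of_one_le (hγ1 : 1 ≤ γ) (hm : 0 < m) (hmM : m ≤ M)
    (ha : 0 ≤ a) (hb : 0 ≤ b) (haN : a ≤ N) (hbN : b ≤ N) (hN : N ≤ a + b) :
    (M + γ * m) * N + max (m * (b - γ * a)) (M * (b - γ * a)) +
      max (m * (a - γ * b)) (M * (a - γ * b)) ≤ 2 * (M * N) := by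
  have hd : 0 ≤ M - m := by linarith
  have hN0 : 0 ≤ N := ha.trans haN
  have e1 := mul_nonneg hd hN0
  have e2 := mul_nonneg (sub_nonneg.2 hγ1) (sub_nonneg.2 hN)
  have hM : 0 < M := hm.trans_le hmM
  have mixed : ∀ {s t : ℝ}, 0 ≤ s → s ≤ N → t ≤ N → N ≤ s + t →
      (M + γ * m) * N + M * (t - γ * s) + m * (s - γ * t) ≤ 2 * (M * N) := by
    intro s t hs hsN htN hst
    have f1 : s * (m - M * γ) ≤ 0 :=
      mul_nonpos_of_nonneg_of_nonpos hs (by nlinarith)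
    rcases le_total (γ * m) M with h | h
    · nlinarith [mul_nonneg (sub_nonneg.2 h) (sub_nonneg.2 htN)]
    · have f2 := mul_le_mul_of_nonneg_left (show N - t ≤ s by linarith) (sub_nonneg.2 h)
      have f3 := mul_nonneg (mul_nonneg hs hd) (show 0 ≤ 1 + γ by linarith)
      nlinarith
  rcases max_cases (m * (b - γ * a)) (M * (b - γ * a)) with ⟨h, -⟩ | ⟨h, -⟩ <;>
  rcases max_cases (m * (a - γ * b)) (M * (a - γ * b)) with ⟨h', -⟩ | ⟨h', -⟩ <;>
  rw [h, h']
  · nlinarith [mul_nonneg hm.le e2]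
  · have := mixed hb hbN haN (by linarith)
    linarith
  · exact mixed ha haN hbN hN
  · nlinarith [mul_nonneg hM.le e2, mul_nonneg (show 0 ≤ γ by linarith) e1]

lemma mul_norm_sub_le_of_left {γ x y a b w : ℝ} (hx : x * a ≤ 0) (hw : 0 ≤ w) :
    w * (√(x ^ 2 + y ^ 2) - √(1 + γ ^ 2) * √((x - a) ^ 2 + (y - b) ^ 2)) ≤
      w * (|b| - γ * |a|) := by
  have := norm_bound_of_left (γ := γ) (y := y) (b := b) hx
  exact mul_le_mul_of_nonneg_left (by linarith) hw

/-- Dual weights `A`, `B` for the two half-planes that bound the excess cost of every agent. -/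
lemma exists_dual_weights {γ m M : ℝ} (a b : ℝ) (hγ : 0 ≤ γ) (hm : 0 < m) (hmM : m ≤ M) :
    ∃ N A B : ℝ, 0 ≤ A ∧ 0 ≤ B ∧ A + B = (M + γ * m) * N ∧
      ∀ w x y : ℝ, m ≤ w → w ≤ M →
        w * (√(x ^ 2 + y ^ 2) - √(1 + γ ^ 2) * √((x - a) ^ 2 + (y - b) ^ 2)) ≤
          M * N - (if x * a ≤ 0 then A else 0) - (if y * b ≤ 0 then B else 0) := by
  have hM : 0 < M := hm.trans_le hmM
  set R := √(a ^ 2 + b ^ 2) with hR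
  have hR0 : 0 ≤ R := Real.sqrt_nonneg _
  have haR : |a| ≤ R := Real.abs_le_sqrt (by nlinarith [sq_nonneg b])
  have hbR : |b| ≤ R := Real.abs_le_sqrt (by nlinarith [sq_nonneg a])
  have hRab : R ≤ |a| + |b| := sqrt_sq_add_sq_le_abs_add_abs a b
  have ha := abs_nonneg a
  have hb := abs_nonneg b
  -- `N` is the ℓ¹ norm of `(a, b)` when `γ ≤ 1` and its Euclidean norm when `γ ≥ 1`.
  obtain ⟨N, hRN, hbudget, hboth⟩ : ∃ N, R ≤ N ∧
      (M + γ * m) * N + max (m * (|b| - γ * |a|)) (M * (|b| - γ * |a|)) +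
        max (m * (|a| - γ * |b|)) (M * (|a| - γ * |b|)) ≤ 2 * (M * N) ∧
      ∀ x y : ℝ, x * a ≤ 0 → y * b ≤ 0 → √(x ^ 2 + y ^ 2) + γ * N ≤
        √(1 + γ ^ 2) * √((x - a) ^ 2 + (y - b) ^ 2) := by
    rcases le_total γ 1 with h | h
    · exact ⟨|a| + |b|, hRab, budget_le_of_le_one hγ hmM ha hb,
        fun x y => norm_bound_of_opposite_of_le_one h⟩
    · exact ⟨R, le_rfl, budget_le_of_one_le h hm hmM ha hb haR hbR hRab,
        fun x y => norm_bound_of_opposite⟩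
  have hN0 : 0 ≤ N := hR0.trans hRN
  have hU := max_mul_sub_le (b := |b|) hγ hm hmM ha (hbR.trans hRN) hN0
  have hV := max_mul_sub_le (b := |a|) hγ hm hmM hb (haR.trans hRN) hN0
  obtain ⟨A, B, hA, hB, hAU, hBV, hAB⟩ := exists_add_eq_of_le_add (sub_nonneg.2 hU)
    (sub_nonneg.2 hV) (show 0 ≤ (M + γ * m) * N by positivity) (by linarith)
  refine ⟨N, A, B, hA, hB, hAB, fun w x y hmw hwM => ?_⟩
  have hw : 0 ≤ w := hm.le.trans hmw
  split_ifs with hx hy hy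
  · have h1 : √(x ^ 2 + y ^ 2) - √(1 + γ ^ 2) * √((x - a) ^ 2 + (y - b) ^ 2) ≤ -(γ * N) := by
      linarith [hboth x y hx hy]
    have h2 := mul_le_mul_of_nonneg_left h1 hw
    have h3 := mul_le_mul_of_nonneg_right hmw (mul_nonneg hγ hN0)
    linarith
  · linarith [mul_norm_sub_le_of_left (γ := γ) (y := y) (b := b) hx hw,
      mul_le_max_of_mem (t := |b| - γ * |a|) hmw hwM]
  · have h1 := mul_norm_sub_le_of_left (γ := γ) (y := x) (b := a) hy hw
    rw [add_comm (y ^ 2), add_comm ((y - b) ^ 2)] at h1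
    linarith [mul_le_max_of_mem (t := |a| - γ * |b|) hmw hwM]
  · have h1 := sqrt_sq_add_sq_sub_le x y a b
    have h2 : 1 ≤ √(1 + γ ^ 2) := Real.one_le_sqrt.2 (by nlinarith [sq_nonneg γ])
    have h3 : √(x ^ 2 + y ^ 2) - √(1 + γ ^ 2) * √((x - a) ^ 2 + (y - b) ^ 2) ≤ N := by
      nlinarith [Real.sqrt_nonneg ((x - a) ^ 2 + (y - b) ^ 2)]
    have h4 := mul_le_mul_of_nonneg_left h3 hw
    have h5 := mul_le_mul_of_nonneg_right hwM hN0
    linarith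

end DualWeights

/-! ### From the certificate to the approximation ratios. -/

section Approximation

variable {n : ℕ}

lemma robustnessBound_eq (c m M : ℝ) : robustnessBound c m M = consistencyBound (-c) m M := by
  simp only [robustnessBound, consistencyBound, sub_neg_eq_add, ← sub_eq_add_neg]

lemma consistencyBound_eq {c m : ℝ} (hc : -1 < c) (hm : 0 < m) (M : ℝ) :
    consistencyBound c m M = √(1 + ((1 - c) * M / ((1 + c) * m)) ^ 2) := by
  have h : 0 < (1 + c) * m := mul_pos (by linarith) hm
  rw [consistencyBound, ← Real.sqrt_sq h.le, ← Real.sqrt_div' _ (sq_nonneg _), Real.sqrt_sq h.le]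
  congr 1
  have : (1 + c) ≠ 0 := by linarith
  field_simp

lemma wMin_pos (hn : 0 < n) {w : Fin n → ℝ} (hw : ∀ i, 0 < w i) : 0 < wMin w := by
  have : Nonempty (Fin n) := ⟨⟨0, hn⟩⟩
  obtain ⟨i, hi⟩ := exists_eq_ciInf_of_finite (f := w)
  rw [wMin, ← hi]
  exact hw i

lemma wMin_le (w : Fin n → ℝ) (i : Fin n) : wMin w ≤ w i :=
  ciInf_le (Set.finite_range w).bddBelow i

lemma le_wMax (w : Fin n → ℝ) (i : Fin n) : w i ≤ wMax w :=
  le_ciSup (Set.finite_range w).bddAbove i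

/-- If in each coordinate a fraction `(1 + c) / 2` of the agents is not on the side of `o` of `f`,
then the cost of `f` is within the bound of the cost of `o`. -/
theorem socialCost_le_of_card_opposite (hn : 0 < n) {w : Fin n → ℝ} (hw : ∀ i, 0 < w i) {c : ℝ}
    (hc : -1 < c) (hc1 : c ≤ 1) (P : Fin n → Plane) (f o : Plane)
    (hcard : ∀ j : Fin 2, (1 + c) * n ≤ 2 * (#{i | (P i j - f j) * (o j - f j) ≤ 0} : ℝ)) :
    socialCost w f P ≤ consistencyBound c (wMin w) (wMax w) * socialCost w o P := by
  have hm := wMin_pos hn hw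
  have hmM : wMin w ≤ wMax w := (wMin_le w ⟨0, hn⟩).trans (le_wMax w ⟨0, hn⟩)
  rw [consistencyBound_eq hc hm]
  set m := wMin w with hmdef
  set M := wMax w with hMdef
  have hM : 0 < M := hm.trans_le hmM
  have hc' : 0 < 1 + c := by linarith
  -- This `γ` makes `√(1 + γ²)` the claimed ratio and also balances the certificate, by `hγm`.
  set γ := (1 - c) * M / ((1 + c) * m) with hγdef
  have hγ : 0 ≤ γ := div_nonneg (mul_nonneg (by linarith) hM.le) (by positivity)
  have hγm : (1 + c) * (M + γ * m) = 2 * M := by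
    rw [hγdef]
    field_simp
    ring
  obtain ⟨N, A, B, hA, hB, hAB, hbound⟩ :=
    exists_dual_weights (o 0 - f 0) (o 1 - f 1) hγ hm hmM
  have hagent : ∀ i, agentCost (w i) f (P i) ≤ √(1 + γ ^ 2) * agentCost (w i) o (P i) +
      (M * N - (if (P i 0 - f 0) * (o 0 - f 0) ≤ 0 then A else 0) -
        (if (P i 1 - f 1) * (o 1 - f 1) ≤ 0 then B else 0)) := by
    intro i
    have h := hbound (w i) (P i 0 - f 0) (P i 1 - f 1) (wMin_le w i) (le_wMax w i)
    rw [sub_sub_sub_cancel_right, sub_sub_sub_cancel_right, ← plane_dist_eq, ← plane_dist_eq] at h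
    rw [agentCost, agentCost, dist_comm f, dist_comm o]
    linarith
  have hsum := Finset.sum_le_sum fun i (_ : i ∈ univ) => hagent i
  simp only [sum_add_distrib, sum_sub_distrib, ← mul_sum, ← sum_filter, sum_const, nsmul_eq_mul,
    card_univ, Fintype.card_fin] at hsum
  have h0 := mul_le_mul_of_nonneg_right (hcard 0) hA
  have h1 := mul_le_mul_of_nonneg_right (hcard 1) hB
  have hid : (1 + c) * n * A + (1 + c) * n * B = 2 * (n * (M * N)) := by
    linear_combination (1 + c) * (n : ℝ) * hAB + (n : ℝ) * N * hγm
  rw [socialCost, socialCost, mul_left_comm]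
  exact mul_le_mul_of_nonneg_left (by linarith) (by positivity)

lemma medianWithCopies_consistent (hn : 0 < n) {w : Fin n → ℝ} (hw : ∀ i, 0 < w i) {c : ℝ}
    (hc : -1 < c) (hc1 : c ≤ 1) {k : ℕ} (hkn : k ≤ n)
    (hk : (1 + c) * n ≤ 2 * (((n + k - 1) / 2 + 1 : ℕ) : ℝ)) :
    Consistent w (consistencyBound c (wMin w) (wMax w)) (medianWithCopies k) := by
  intro P o _
  refine socialCost_le_of_card_opposite hn hw hc hc1 P _ o fun j => hk.trans ?_
  have := card_opposite_prediction k P o j hn hkn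
  gcongr

lemma medianWithCopies_robust (hn : 0 < n) {w : Fin n → ℝ} (hw : ∀ i, 0 < w i) {c : ℝ}
    (hc : -1 ≤ c) (hc1 : c < 1) {k : ℕ}
    (hk : (1 - c) * n + 2 * k ≤ 2 * (((n + k - 1) / 2 + 1 : ℕ) : ℝ)) :
    Robust w (robustnessBound c (wMin w) (wMax w)) (medianWithCopies k) := by
  intro P ohat o _
  rw [robustnessBound_eq]
  refine socialCost_le_of_card_opposite hn hw (by linarith) (by linarith) P _ o fun j => ?_
  have h := card_opposite_arbitrary k P ohat j hn o
  have h' := Nat.cast_le (α := ℝ).2 h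
  push_cast at h' hk
  linarith

/-- A number of copies of odd parity relative to `n`, within distance one of `c * n`. -/
lemma exists_odd_copies (hn : 0 < n) {c : ℝ} (hc0 : 0 ≤ c) (hc1 : c < 1) :
    ∃ k : ℕ, k ≤ n ∧ (n + k) % 2 = 1 ∧ (k : ℝ) ≤ c * n + 1 ∧ c * n ≤ k + 1 := by
  have hn' : (0 : ℝ) < n := by exact_mod_cast hn
  have h0 : 0 ≤ c * n := by positivity
  have h1 := Nat.floor_le h0
  have h2 := Nat.lt_floor_add_one (c * n)
  have h3 : ⌊c * n⌋₊ < n := (Nat.floor_lt h0).2 (by nlinarith)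
  rcases Nat.mod_two_eq_zero_or_one (n + ⌊c * n⌋₊) with h | h
  · refine ⟨⌊c * n⌋₊ + 1, h3, by omega, ?_, ?_⟩ <;> push_cast <;> linarith
  · exact ⟨⌊c * n⌋₊, h3.le, h, by linarith, h2.le⟩

lemma cmp_eq_medianWithCopies (c : ℝ) :
    (cmp c : Mechanism n) = medianWithCopies ⌊c * (n : ℝ)⌋₊ := rfl

lemma add_le_two_mul_half (n k : ℕ) :
    (n : ℝ) + k ≤ 2 * (((n + k - 1) / 2 + 1 : ℕ) : ℝ) := by
  exact_mod_cast (by omega : n + k ≤ 2 * ((n + k - 1) / 2 + 1))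

end Approximation

end FacilityLocation

open FacilityLocation in
theorem theorem1 (n : ℕ) (hn : 0 < n) (c : ℝ) (hc0 : 0 ≤ c) (hc1 : c < 1) :
    -- for every confidence `c`, a deterministic strategyproof mechanism attains both guarantees
    (∃ f : Mechanism n, ∀ w : Fin n → ℝ, (∀ i, 0 < w i) →
      Strategyproof w f ∧
      Consistent w (consistencyBound c (wMin w) (wMax w)) f ∧
      Robust w (robustnessBound c (wMin w) (wMax w)) f) ∧
    -- the CMP mechanism is strategyproof and robust for every `c`, and consistent if `c n` is
    -- an integer (so that exactly `c n` copies of the prediction are added)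
    (∀ w : Fin n → ℝ, (∀ i, 0 < w i) →
      Strategyproof w (cmp c) ∧
      Robust w (robustnessBound c (wMin w) (wMax w)) (cmp c) ∧
      ((∃ m : ℕ, c * (n : ℝ) = (m : ℝ)) →
        Consistent w (consistencyBound c (wMin w) (wMax w)) (cmp c))) := by
  constructor
  · obtain ⟨k, hkn, hodd, hk1, hk2⟩ := exists_odd_copies hn hc0 hc1
    -- Odd `n + k` gains the extra `1`, which pays for rounding `c * n` in both guarantees. `cmp`
    -- may have `n + k` even and lack it, hence the integrality condition for its consistency.
    have hhalf : 2 * (((n + k - 1) / 2 + 1 : ℕ) : ℝ) = n + k + 1 := by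
      exact_mod_cast (by omega : 2 * ((n + k - 1) / 2 + 1) = n + k + 1)
    refine ⟨medianWithCopies k, fun w hw => ⟨medianWithCopies_strategyproof k hw, ?_, ?_⟩⟩
    · exact medianWithCopies_consistent hn hw (by linarith) hc1.le hkn (by linarith)
    · exact medianWithCopies_robust hn hw (by linarith) hc1 (by linarith)
  · intro w hw
    have hfloor := Nat.floor_le (show 0 ≤ c * (n : ℝ) by positivity)
    rw [cmp_eq_medianWithCopies]
    have hhalf := add_le_two_mul_half n ⌊c * (n : ℝ)⌋₊
    refine ⟨medianWithCopies_strategyproof _ hw,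
      medianWithCopies_robust hn hw (by linarith) hc1 (by linarith), ?_⟩
    rintro ⟨m, hm⟩
    have hkn : ⌊c * (n : ℝ)⌋₊ ≤ n :=
      Nat.floor_le_of_le (mul_le_of_le_one_left (Nat.cast_nonneg n) hc1.le)
    have hfl : ((⌊c * (n : ℝ)⌋₊ : ℕ) : ℝ) = c * n := by
      rw [hm, Nat.floor_natCast]
    exact medianWithCopies_consistent hn hw (by linarith) hc1.le hkn (by linarith)
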